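/- Let $S$ be a set of $n$ points in the Euclidean plane in convex position (the vertex set of a convex $n$-gon). Let $d_1>d_2>\dotsb$ be the distinct distances between pairs of points of $S$, and let $m_i$ be the number of unordered pairs of points of $S$ at distance $d_i$ from one another ($m_i=0$ if there are fewer than $i$ distances). Then, for all sufficiently large $n$, every such $S$ satisfies $$m_2\le \tfrac43\,n .$$ More precisely, call a real number $C$ admissible for $(k,\ell)$ if every set of $n$ points in convex position (for any $n$) that contains two distinct vertices $a,b$ with $|ab|\ge d_k$ and with at most $\ell$ vertices strictly between $a$ and $b$ on one of the two boundary arcs joining them satisfies $m_1+\dotsb+m_k\le n+C$. Then an admissible constant for $(k,\ell)=(2,16)$ exists, and for every such constant $C=C(2,16)$, the inequality $m_2\le\frac43 n$ holds for every set of $n$ points in convex position with $n\ge 3\,C(2,16)$. -/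

import Mathlib

/-- The Euclidean plane. -/
abbrev Plane : Type := EuclideanSpace ℝ (Fin 2)

/-- A finite point set is in convex position (it is the vertex set of a convex polygon) if no point
of it lies in the convex hull of the others. -/
def InConvexPosition (S : Finset Plane) : Prop :=
  ConvexIndependent ℝ (fun x : S => (x : Plane))

open scoped Classical in
/-- The set of all distances between two distinct points of `S`. -/
noncomputable def distances (S : Finset Plane) : Finset ℝ :=
  S.offDiag.image (fun p => dist p.1 p.2)

open scoped Classical in
/-- `IsNthDistance S i r`: the number `r` is the `i`-th largest distance `d_i` of `S`
(`i = 1, 2, …`), that is, `r` is a distance of `S` and exactly `i - 1` distances of `S` exceed it. -/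
def IsNthDistance (S : Finset Plane) (i : ℕ) (r : ℝ) : Prop :=
  r ∈ distances S ∧ ((distances S).filter (fun s => r < s)).card + 1 = i

open scoped Classical in
/-- `distMultiplicity S i` is `m_i`: the number of unordered pairs of points of `S` at distance `d_i`
from one another (it is `0` if `S` has fewer than `i` distances). -/
noncomputable def distMultiplicity (S : Finset Plane) (i : ℕ) : ℕ :=
  ((S.offDiag.filter (fun p => IsNthDistance S i (dist p.1 p.2))).image
    (fun p => s(p.1, p.2))).card

/-- The number of top-`k` distances, `m_1 + ⋯ + m_k`. -/
noncomputable def topMultiplicity (S : Finset Plane) (k : ℕ) : ℕ :=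
  ∑ i ∈ Finset.Icc 1 k, distMultiplicity S i

/-- Twice the signed area of the triangle `a b x`; it is positive iff `x` lies strictly to the left
of the line from `a` to `b`. -/
def orient (a b x : Plane) : ℝ :=
  (b 0 - a 0) * (x 1 - a 1) - (b 1 - a 1) * (x 0 - a 0)

open scoped Classical in
/-- The vertices strictly between `a` and `b` on the boundary of the convex polygon with vertex set
`S`, when one walks clockwise from `a` to `b`: those strictly to the left of the line from `a` to
`b`. The vertices on the other boundary arc are `verticesBetween S b a`. -/
noncomputable def verticesBetween (S : Finset Plane) (a b : Plane) : Finset Plane :=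
  S.filter (fun x => 0 < orient a b x)

/-- Some diagonal (or side) `ab` of `S` has length at least `d_k` and at most `l` vertices between
its endpoints, on one of the two boundary arcs (the pair `a`, `b` is ordered, so both arcs are
allowed). -/
def HasSpecialDiagonal (S : Finset Plane) (k l : ℕ) : Prop :=
  ∃ a ∈ S, ∃ b ∈ S, a ≠ b ∧ (∃ r, IsNthDistance S k r ∧ r ≤ dist a b) ∧
    (verticesBetween S a b).card ≤ l

/-- `C` is an admissible value of the constant `C(k, l)`: every set of `n` points in convex position
having a diagonal of length at least `d_k` with at most `l` vertices between its endpoints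
satisfies `m_1 + ⋯ + m_k ≤ n + C`. -/
def IsSpecialDiagonalConstant (k l : ℕ) (C : ℝ) : Prop :=
  ∀ S : Finset Plane, InConvexPosition S → HasSpecialDiagonal S k l →
    (topMultiplicity S k : ℝ) ≤ (S.card : ℝ) + C

/-!
For vertices `i, j, k, l` of a convex polygon in this cyclic order, the diagonals beat the sides:
`|ij| + |kl| < |ik| + |jl|`. Hence two edges at distance `d₁` or `d₂` that face each other as
opposite sides of a quadrilateral force one of its diagonals to have length `d₁`, and never both
have length `d₁`.

Orient every edge of the graph of `d₂` both ways. At each vertex `p` at most one oriented edge `pq`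
is the last one counterclockwise, so all but `2n` of the `2 m₂` oriented edges `pq` are such that
rotating them in the same sense about either endpoint leads to another edge: they are middle edges
of zigzags. The chord joining the two free ends of a zigzag has length `d₁`, and it determines the
zigzag: two zigzags with the same ends would either violate the inequality above or produce a
convex quadrilateral with four acute angles. These chords form a matching, and for no chord `ab`
are the vertices following `a` and `b` both matched. So at most `2n/3` vertices are matched, there
are at most `2n/3` zigzags, and `2 m₂ ≤ 2n + 2n/3`.

For the constant `C(2, ℓ)`: given a chord `ab` of length at least `d₂` with `ℓ` vertices on one
side, an edge of length `d₁` or `d₂` on its other side faces `ab`, so it has an endpoint at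
distance `d₁` from `a` or from `b`, and at most two vertices arise in this way from each. So
`ℓ + 6` vertices cover all edges, and since two circles meet in at most two points, a cover by a
bounded number of vertices leaves at most `n + O(1)` edges.
-/

section Counting

open Finset

variable {α : Type*}

theorem card_add_card_filter_perm_notMem_le [Fintype α] [DecidableEq α] (e : Equiv.Perm α)
    (W : Finset α) :
    #W + #{x ∈ W | e x ∉ W} ≤ Fintype.card α := by
  rw [← card_map e.toEmbedding (s := W.filter _), ← card_union_of_disjoint]
  · exact card_le_univ _
  · simp [disjoint_right]

theorem card_le_one_add_card_offDiag (s : Finset α) : #s ≤ 1 + #s.offDiag := by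
  rw [offDiag_card]
  have : 2 * #s ≤ 1 + #s * #s := by nlinarith [sq_nonneg ((#s : ℤ) - 1)]
  lia

theorem card_edgeFinset_le_sum_degree_of_isVertexCover [Fintype α] {G : SimpleGraph α}
    [DecidableRel G.Adj] {F : Finset α} (hF : G.IsVertexCover F) :
    #G.edgeFinset ≤ ∑ u ∈ F, G.degree u := by
  classical
  have covered : G.edgeFinset ⊆ F.biUnion (G.incidenceFinset ·) := by
    intro e he
    induction e with | h u w
    rw [SimpleGraph.mem_edgeFinset, SimpleGraph.mem_edgeSet] at he
    have := hF he
    simp only [mem_biUnion, SimpleGraph.mem_incidenceFinset, SimpleGraph.mk'_mem_incidenceSet_iff]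
    grind
  simpa only [SimpleGraph.card_incidenceFinset_eq_degree] using
    (card_le_card covered).trans card_biUnion_le

theorem card_edgeFinset_le_of_isVertexCover [Fintype α] {G : SimpleGraph α} [DecidableRel G.Adj]
    {F : Finset α} {c : ℕ} (hF : G.IsVertexCover F)
    (hc : ∀ u ∈ F, ∀ u' ∈ F, u ≠ u' → #{w | G.Adj u w ∧ G.Adj u' w} ≤ c) :
    #G.edgeFinset ≤ Fintype.card α + c * #F ^ 2 := by
  classical
  calc #G.edgeFinset
      ≤ ∑ u ∈ F, #{w | G.Adj u w} := by
        simpa only [← SimpleGraph.card_neighborFinset_eq_degree,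
          SimpleGraph.neighborFinset_eq_filter] using
          card_edgeFinset_le_sum_degree_of_isVertexCover hF
    _ = ∑ w, #{u ∈ F | G.Adj u w} := sum_card_bipartiteAbove_eq_sum_card_bipartiteBelow _
    _ ≤ ∑ w, (1 + #{p ∈ F.offDiag | G.Adj p.1 w ∧ G.Adj p.2 w}) := by
        gcongr with w
        have pairs : {p ∈ F.offDiag | G.Adj p.1 w ∧ G.Adj p.2 w} =
            offDiag {u ∈ F | G.Adj u w} := by
          grind
        exact pairs ▸ card_le_one_add_card_offDiag _
    _ = Fintype.card α + ∑ p ∈ F.offDiag, #{w | G.Adj p.1 w ∧ G.Adj p.2 w} := by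
        rw [sum_add_distrib, ← card_eq_sum_ones, card_univ]
        congr 1
        exact (sum_card_bipartiteAbove_eq_sum_card_bipartiteBelow _).symm
    _ ≤ Fintype.card α + #F.offDiag * c := by
        gcongr
        refine sum_le_card_nsmul _ _ _ fun p hp => ?_
        obtain ⟨h1, h2, h3⟩ := mem_offDiag.1 hp
        exact hc _ h1 _ h2 h3
    _ ≤ Fintype.card α + c * #F ^ 2 := by
        rw [mul_comm, offDiag_card, sq]
        gcongr
        exact Nat.sub_le _ _

end Counting

section CyclicOrder

variable {α : Type*} [CircularOrder α] {a b c d : α}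

attribute [local grind →] SBtw.sbtw.cyclic_left SBtw.sbtw.trans_left

@[local grind →]
theorem ne_of_sbtw (h : sbtw a b c) : a ≠ b := by
  rintro rfl
  exact sbtw_irrefl_left h

@[local grind .]
theorem sbtw_or_sbtw_of_ne (hab : a ≠ b) (hbc : b ≠ c) (hac : a ≠ c) :
    sbtw a b c ∨ sbtw c b a := by
  rw [sbtw_iff_not_btw, sbtw_iff_not_btw, ← not_and_or]
  rintro ⟨h, h'⟩
  rcases h.antisymm h' with h | h | h
  exacts [hbc h.symm, hab h.symm, hac h]

theorem exists_sbtw_sbtw_of_two_lt_card {X : Finset α} (ha : a ∉ X) (hX : 2 < X.card) :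
    ∃ i ∈ X, ∃ j ∈ X, ∃ k ∈ X, sbtw a i j ∧ sbtw a j k := by
  obtain ⟨i, hi, j, hj, k, hk, hij, hik, hjk⟩ := Finset.two_lt_card.1 hX
  have ne_of_mem : ∀ x ∈ X, a ≠ x := fun x hx h => ha (h ▸ hx)
  grind

/-- `a`, `b`, `c`, `d` are distinct and occur in this cyclic order. -/
@[local grind =]
def CyclicQuad (a b c d : α) : Prop :=
  sbtw a b c ∧ sbtw a c d

/-- `c` is the immediate successor of `a` in the cyclic order. -/
@[local grind =]
def IsNext (a c : α) : Prop :=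
  ∀ z, z ≠ a → z = c ∨ sbtw a c z

theorem isNext_finRotate {n : ℕ} (i : Fin n) : IsNext i (finRotate n i) := by
  intro z hz
  rw [Fin.sbtw_iff]
  obtain _ | m := n
  · exact i.elim0
  · rw [finRotate_apply]
    rcases Fin.eq_castSucc_or_eq_last i with ⟨j, rfl⟩ | rfl
    · simp only [Fin.coeSucc_eq_succ]
      grind
    · simp only [Fin.last_add_one]
      grind

/-- The edges `p y`, `p q`, `q x` form a zigzag on the two sides of its middle edge `p q`:
rotating `p q` in the same direction about either endpoint leads to another edge. -/
@[local grind =]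
def Zigzag (G : SimpleGraph α) (p q x y : α) : Prop :=
  CyclicQuad p x q y ∧ G.Adj p q ∧ G.Adj p y ∧ G.Adj q x

/-- The chord `x y` joins the two free ends of a zigzag of `G`. -/
def ZigzagEnds (G : SimpleGraph α) (x y : α) : Prop :=
  ∃ p q, Zigzag G p q x y

theorem Zigzag.symm {G : SimpleGraph α} {p q x y : α} (h : Zigzag G p q x y) :
    Zigzag G q p y x := by
  grind [SimpleGraph.adj_comm]

theorem ZigzagEnds.symm {G : SimpleGraph α} {x y : α} :
    ZigzagEnds G x y → ZigzagEnds G y x :=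
  fun ⟨p, q, h⟩ => ⟨q, p, h.symm⟩

theorem ZigzagEnds.ne {G : SimpleGraph α} {x y : α} : ZigzagEnds G x y → x ≠ y :=
  fun ⟨_, _, h⟩ => by grind

open Finset in
open scoped Classical in
theorem two_mul_card_edgeFinset_le_add_card_zigzag [Fintype α] (G : SimpleGraph α) :
    2 * #G.edgeFinset ≤
      2 * Fintype.card α + #{e : α × α | ∃ x y, Zigzag G e.1 e.2 x y} := by
  set M : Finset (α × α) := {e | G.Adj e.1 e.2 ∧ ∀ z, G.Adj e.1 z → ¬ sbtw e.1 e.2 z}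
  set Z : Finset (α × α) := {e | ∃ x y, Zigzag G e.1 e.2 x y}
  have card_M : #M ≤ Fintype.card α := by
    refine card_le_card_of_injOn Prod.fst (fun _ _ => mem_univ _) ?_
    rintro ⟨x, y⟩ h ⟨x', y'⟩ h' (rfl : x = x')
    simp only [M, coe_filter, mem_univ, true_and, Set.mem_ofPred_eq] at h h'
    have := h.1.ne
    have := h'.1.ne
    grind
  have covered : univ.filter (fun e : α × α => G.Adj e.1 e.2) ⊆ M ∪ M.image Prod.swap ∪ Z := by
    rintro ⟨p, q⟩ hpq
    replace hpq : G.Adj p q := by simpa using hpq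
    by_cases hp : ∃ y, G.Adj p y ∧ sbtw p q y
    · by_cases hq : ∃ x, G.Adj q x ∧ sbtw q p x
      · obtain ⟨y, hpy, hy⟩ := hp
        obtain ⟨x, hqx, hx⟩ := hq
        have : Zigzag G p q x y := ⟨by grind, hpq, hpy, hqx⟩
        grind
      · have : (q, p) ∈ M := by grind [hpq.symm]
        grind
    · grind
  rw [G.two_mul_card_edgeFinset]
  calc _ ≤ #(M ∪ M.image Prod.swap ∪ Z) := card_le_card covered
    _ ≤ _ := by
      grw [card_union_le, card_union_le, card_image_le, card_M, two_mul]

/-- What the combinatorial argument uses about the graph `G₁` of the largest distance and the graph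
`G₂` of the second largest distance on the cyclically ordered vertices of a convex polygon. -/
structure IsTopTwo (G₁ G₂ : SimpleGraph α) : Prop where
  disjoint {i j} : G₁.Adj i j → ¬ G₂.Adj i j
  cross {i j k l} : CyclicQuad i j k l → G₁.Adj i j → ¬ G₁.Adj k l
  cross_mixed {i j k l} : CyclicQuad i j k l → G₁.Adj i j → G₂.Adj k l → G₁.Adj i k ∧ G₁.Adj j l
  cross_second {i j k l} :
    CyclicQuad i j k l → G₂.Adj i j → G₂.Adj k l → G₁.Adj i k ∨ G₁.Adj j l
  hexagon {p r x s q y} : CyclicQuad p r x s → CyclicQuad p s q y → G₂.Adj r y → G₂.Adj p y →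
    G₂.Adj p q → G₂.Adj r s → G₂.Adj x s → ¬ G₂.Adj x q

namespace IsTopTwo

variable {G₁ G₂ : SimpleGraph α} (h : IsTopTwo G₁ G₂) {p q r s x y : α}

include h

theorem adj_of_zigzagEnds (hxy : ZigzagEnds G₂ x y) : G₁.Adj x y := by
  obtain ⟨p, q, hpq⟩ := hxy
  grind [h.cross_second (i := y) (j := p) (k := x) (l := q), h.disjoint (i := p) (j := q),
    SimpleGraph.adj_comm]

theorem zigzag_unique_of_sbtw (h₁ : Zigzag G₂ p q x y) (h₂ : Zigzag G₂ r s x y)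
    (hpr : sbtw p r x) : False := by
  by_cases hqs : q = s ∨ sbtw p q s
  · have quad : CyclicQuad y p r s := by grind
    rcases h.cross_second quad h₁.2.2.1.symm h₂.2.1 with hyr | hps
    · exact h.disjoint hyr.symm h₂.2.2.1
    · rcases hqs with rfl | hqs
      · exact h.disjoint hps h₁.2.1
      · have quad : CyclicQuad s p x q := by grind
        exact h.disjoint (h.cross_mixed quad hps.symm h₁.2.2.2.symm).2 h₁.2.1
  · have hpxy : sbtw p x y := by grind
    have hxsy : sbtw x s y := by grind
    have hxs : sbtw p x s := (hxsy.cyclic_left.trans_left hpxy.cyclic_right).cyclic_left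
    have hsq : sbtw p s q := by grind
    exact h.hexagon ⟨hpr, hxs⟩ ⟨hsq, h₁.1.2⟩ h₂.2.2.1 h₁.2.2.1 h₁.2.1 h₂.2.1
      h₂.2.2.2.symm h₁.2.2.2.symm

theorem zigzag_unique_left (h₁ : Zigzag G₂ p q x y) (h₂ : Zigzag G₂ r s x y) : p = r := by
  by_contra hne
  have := h.zigzag_unique_of_sbtw h₁ h₂
  have := h.zigzag_unique_of_sbtw h₂ h₁
  grind

theorem zigzag_unique (h₁ : Zigzag G₂ p q x y) (h₂ : Zigzag G₂ r s x y) :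
    (p, q) = (r, s) :=
  Prod.ext (h.zigzag_unique_left h₁ h₂) (h.zigzag_unique_left h₁.symm h₂.symm)

theorem not_adj_of_zigzagEnds_of_sbtw (hxy : ZigzagEnds G₂ x y) {w : α} (hw : sbtw y w x) :
    ¬ G₁.Adj y w := by
  intro hyw
  obtain ⟨p, q, quad, hpq, hpy, hqx⟩ := hxy
  have hwq : G₁.Adj w q := (h.cross_mixed (by grind) hyw hqx.symm).2
  by_cases hpw : p = w
  · exact h.disjoint (hpw ▸ hwq) hpq
  by_cases hc : sbtw p w x
  · exact h.disjoint (h.cross_mixed (by grind) hwq hpy.symm).2 hpq.symm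
  · exact h.disjoint (h.cross_mixed (by grind) hyw hpq).1 hpy.symm

theorem zigzagEnds_unique_right {y' : α} (hy : ZigzagEnds G₂ x y) (hy' : ZigzagEnds G₂ x y') :
    y = y' := by
  by_contra hne
  have := h.not_adj_of_zigzagEnds_of_sbtw hy.symm (w := y')
  have := h.not_adj_of_zigzagEnds_of_sbtw hy'.symm (w := y)
  grind [hy.ne, hy'.ne, h.adj_of_zigzagEnds hy, h.adj_of_zigzagEnds hy']

theorem eq_of_zigzag_of_isNext {a b c d : α} (hab : ZigzagEnds G₂ a b) (hac : IsNext a c)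
    (hquad : CyclicQuad a c b d) (hcd : Zigzag G₂ p q c d) : p = a := by
  by_contra hpa
  have hpb : sbtw b p a := by
    have := hac p hpa
    grind
  have hquad : CyclicQuad a b d p := by grind
  have hbp : G₁.Adj b p :=
    (h.cross_mixed hquad (h.adj_of_zigzagEnds hab) hcd.2.2.1.symm).2
  exact h.not_adj_of_zigzagEnds_of_sbtw hab hpb hbp

theorem sbtw_of_zigzagEnds_of_isNext {a b c c' : α} (hab : ZigzagEnds G₂ a b)
    (hac : IsNext a c) (hcc' : ZigzagEnds G₂ c c') : sbtw a c b ∧ sbtw b c' a := by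
  obtain ⟨p₀, q₀, hpq⟩ := id hab
  have hacb : sbtw a c b := by
    have := hac q₀
    grind
  have hca : c' ≠ a := by
    rintro rfl
    grind [h.zigzagEnds_unique_right hab hcc'.symm]
  have hcb : c' ≠ b := by
    rintro rfl
    grind [h.zigzagEnds_unique_right hab.symm hcc'.symm]
  refine ⟨hacb, by_contra fun hcon => ?_⟩
  have := hac c' hca
  have quad : CyclicQuad b a c c' := by grind [hcc'.ne]
  exact h.cross quad (h.adj_of_zigzagEnds hab).symm (h.adj_of_zigzagEnds hcc')

theorem not_zigzagEnds_of_isNext {a b c d c' d' : α} (hab : ZigzagEnds G₂ a b)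
    (hac : IsNext a c) (hbd : IsNext b d) (hcc' : ZigzagEnds G₂ c c') :
    ¬ ZigzagEnds G₂ d d' := by
  intro hdd'
  obtain ⟨hc, hc'⟩ := h.sbtw_of_zigzagEnds_of_isNext hab hac hcc'
  obtain ⟨hd, hd'⟩ := h.sbtw_of_zigzagEnds_of_isNext hab.symm hbd hdd'
  have hcd : c' = d := by
    by_contra hne
    have hne' : d' ≠ c := by
      rintro rfl
      exact hne (h.zigzagEnds_unique_right hcc' hdd'.symm)
    have hcd'b : sbtw c d' b := by grind [hac d']
    have hdc'a : sbtw d c' a := by grind [hbd c']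
    have quad : CyclicQuad c' c d' d := by
      grind
    exact h.cross quad (h.adj_of_zigzagEnds hcc').symm (h.adj_of_zigzagEnds hdd').symm
  subst hcd
  obtain ⟨p, q, hpq⟩ := hcc'
  have hpa : p = a := h.eq_of_zigzag_of_isNext hab hac (by grind) hpq
  have hqb : q = b := h.eq_of_zigzag_of_isNext hab.symm hbd (by grind) hpq.symm
  exact h.disjoint (h.adj_of_zigzagEnds hab) (hpa ▸ hqb ▸ hpq.2.1)

open Finset in
open scoped Classical in
theorem three_mul_card_zigzagEnds_le [Fintype α] {e : Equiv.Perm α}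
    (he : ∀ a, IsNext a (e a)) :
    3 * #{x | ∃ y, ZigzagEnds G₂ x y} ≤ 2 * Fintype.card α := by
  set W : Finset α := {x | ∃ y, ZigzagEnds G₂ x y}
  have mem_W {x : α} : x ∈ W ↔ ∃ y, ZigzagEnds G₂ x y := by simp [W]
  have card_inner_le : #{x ∈ W | e x ∈ W} ≤ #{x ∈ W | e x ∉ W} := by
    refine card_le_card_of_forall_subsingleton (ZigzagEnds G₂) ?_ ?_
    · intro a ha
      obtain ⟨ha, hea⟩ := mem_filter.1 ha
      obtain ⟨b, hab⟩ := mem_W.1 ha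
      obtain ⟨c', hc'⟩ := mem_W.1 hea
      refine ⟨b, mem_filter.2 ⟨mem_W.2 ⟨a, hab.symm⟩, fun heb => ?_⟩, hab⟩
      obtain ⟨d', hd'⟩ := mem_W.1 heb
      exact h.not_zigzagEnds_of_isNext hab (he a) (he b) hc' hd'
    · rintro b - a ⟨-, hab⟩ a' ⟨-, hab'⟩
      exact h.zigzagEnds_unique_right hab.symm hab'.symm
  have := card_add_card_filter_perm_notMem_le e W
  have := W.card_filter_add_card_filter_not (e · ∈ W)
  lia

open Finset in
open scoped Classical in
theorem card_zigzag_le [Fintype α] :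
    #{e : α × α | ∃ x y, Zigzag G₂ e.1 e.2 x y} ≤ #{x | ∃ y, ZigzagEnds G₂ x y} := by
  refine card_le_card_of_forall_subsingleton (fun e x => ∃ y, Zigzag G₂ e.1 e.2 x y) ?_ ?_
  · intro e he
    obtain ⟨x, y, hxy⟩ := (mem_filter.1 he).2
    exact ⟨x, mem_filter.2 ⟨mem_univ _, y, e.1, e.2, hxy⟩, y, hxy⟩
  · rintro x - e ⟨-, y, hy⟩ e' ⟨-, y', hy'⟩
    obtain rfl := h.zigzagEnds_unique_right ⟨_, _, hy⟩ ⟨_, _, hy'⟩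
    exact h.zigzag_unique hy hy'

open Finset in
open scoped Classical in
theorem three_mul_card_edgeFinset_le [Fintype α] {e : Equiv.Perm α}
    (he : ∀ a, IsNext a (e a)) : 3 * #G₂.edgeFinset ≤ 4 * Fintype.card α := by
  have := two_mul_card_edgeFinset_le_add_card_zigzag G₂
  have := h.card_zigzag_le
  have := h.three_mul_card_zigzagEnds_le he
  lia

theorem cross_sup_mixed {i j k l : α} (quad : CyclicQuad i j k l) (hij : G₁.Adj i j)
    (hkl : (G₁ ⊔ G₂).Adj k l) : G₁.Adj i k ∧ G₁.Adj j l :=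
  hkl.elim (fun hkl => (h.cross quad hij hkl).elim) (h.cross_mixed quad hij)

theorem cross_sup {i j k l : α} (quad : CyclicQuad i j k l) (hij : (G₁ ⊔ G₂).Adj i j)
    (hkl : (G₁ ⊔ G₂).Adj k l) : G₁.Adj i k ∨ G₁.Adj j l := by
  rcases hij with hij | hij
  · exact .inl (h.cross_sup_mixed quad hij hkl).1
  rcases hkl with hkl | hkl
  · exact .inl (h.cross_mixed (by grind) hkl hij).1.symm
  · exact h.cross_second quad hij hkl

open Finset in
open scoped Classical in
theorem card_crossing_left_le_two [Fintype α] (a b : α) :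
    #{i | G₁.Adj a i ∧ ∃ j, CyclicQuad a b i j ∧ (G₁ ⊔ G₂).Adj i j} ≤ 2 := by
  by_contra! hX
  obtain ⟨i₁, hi₁, i₂, hi₂, i₃, hi₃, h₁₂, h₂₃⟩ :=
    exists_sbtw_sbtw_of_two_lt_card (a := a) (by simp) hX
  obtain ⟨-, hai₁, -⟩ := mem_filter.1 hi₁
  obtain ⟨-, hai₂, -⟩ := mem_filter.1 hi₂
  obtain ⟨-, -, j, quad, hij⟩ := mem_filter.1 hi₃
  have hi₂j : G₁.Adj i₂ j := (h.cross_sup_mixed ⟨h₂₃, quad.2⟩ hai₂ hij).2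
  exact h.cross (by grind) hi₂j hai₁

open Finset in
open scoped Classical in
theorem card_crossing_right_le_two [Fintype α] (a b : α) :
    #{j | G₁.Adj b j ∧ ∃ i, CyclicQuad a b i j ∧ (G₁ ⊔ G₂).Adj i j} ≤ 2 := by
  by_contra! hY
  obtain ⟨j₁, hj₁, j₂, hj₂, j₃, hj₃, h₁₂, h₂₃⟩ :=
    exists_sbtw_sbtw_of_two_lt_card (a := b) (by simp) hY
  obtain ⟨-, -, i, quad, hij⟩ := mem_filter.1 hj₁
  obtain ⟨-, hbj₂, -⟩ := mem_filter.1 hj₂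
  obtain ⟨-, hbj₃, -⟩ := mem_filter.1 hj₃
  have hj₂i : G₁.Adj j₂ i := (h.cross_sup_mixed (by grind) hbj₂.symm hij).1
  exact h.cross (by grind) hbj₃.symm hj₂i.symm

open Finset in
open scoped Classical in
theorem exists_isVertexCover [Fintype α] {a b : α} (hab : (G₁ ⊔ G₂).Adj a b) :
    ∃ F : Finset α, (G₁ ⊔ G₂).IsVertexCover F ∧ #F ≤ #{i | sbtw b a i} + 6 := by
  set X : Finset α := {i | G₁.Adj a i ∧ ∃ j, CyclicQuad a b i j ∧ (G₁ ⊔ G₂).Adj i j}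
  set Y : Finset α := {j | G₁.Adj b j ∧ ∃ i, CyclicQuad a b i j ∧ (G₁ ⊔ G₂).Adj i j}
  set L : Finset α := {i | sbtw b a i}
  refine ⟨L ∪ ({a, b} ∪ X ∪ Y), fun i j hij => ?_, ?_⟩
  · have mem_of_quad {i j : α} (quad : CyclicQuad a b i j) (hij : (G₁ ⊔ G₂).Adj i j) :
        i ∈ X ∨ j ∈ Y :=
      (h.cross_sup quad hab hij).imp (fun hai => mem_filter.2 ⟨mem_univ _, hai, j, quad, hij⟩)
        fun hbj => mem_filter.2 ⟨mem_univ _, hbj, i, quad, hij⟩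
    have mem_L {i : α} : i ∈ L ↔ sbtw b a i := by simp [L]
    have := mem_of_quad (i := i) (j := j)
    have := mem_of_quad (i := j) (j := i)
    have := hab.ne
    have := hij.ne
    clear_value X Y L
    simp only [mem_coe, mem_union, mem_insert, mem_singleton]
    grind [SimpleGraph.adj_comm]
  · have := h.card_crossing_left_le_two a b
    have := h.card_crossing_right_le_two a b
    grw [card_union_le, card_union_le, card_union_le, card_le_two]
    lia

end IsTopTwo

end CyclicOrder

section Geometry

open scoped RealInnerProductSpace

theorem inner_sub_sub_pos_of_dist_le {V : Type*} [NormedAddCommGroup V] [InnerProductSpace ℝ V]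
    {p r y : V} (hne : r ≠ p) (h : dist r y ≤ dist p y) : 0 < ⟪r - p, y - p⟫ := by
  have norm_le : ‖(r - p) - (y - p)‖ ^ 2 ≤ ‖y - p‖ ^ 2 := by
    rw [sub_sub_sub_cancel_right, ← dist_eq_norm, ← dist_eq_norm, dist_comm y]
    gcongr
  rw [norm_sub_sq_real] at norm_le
  have : 0 < ‖r - p‖ := norm_sub_pos_iff.2 hne
  nlinarith

theorem dist_add_dist_lt_of_wbtw {V P : Type*} [NormedAddCommGroup V] [NormedSpace ℝ V]
    [StrictConvexSpace ℝ V] [MetricSpace P] [NormedAddTorsor V P] {a b c d o : P}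
    (hac : Wbtw ℝ a o c) (hbd : Wbtw ℝ b o d) (hab : ¬ Wbtw ℝ a o b) :
    dist a b + dist c d < dist a c + dist b d := by
  have hlt : dist a b < dist a o + dist o b :=
    (dist_triangle a o b).lt_of_ne fun h => hab (dist_add_dist_eq_iff.1 h.symm)
  calc dist a b + dist c d < (dist a o + dist o b) + (dist c o + dist o d) :=
        add_lt_add_of_lt_of_le hlt (dist_triangle c o d)
    _ = (dist a o + dist o c) + (dist b o + dist o d) := by
        rw [dist_comm o b, dist_comm c o]; ring
    _ = dist a c + dist b d := by rw [hac.dist_add_dist, hbd.dist_add_dist]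

variable {a b c d p q r x y z : Plane}

theorem inner_plane_eq (x y : Plane) : ⟪x, y⟫ = x 0 * y 0 + x 1 * y 1 := by
  simp [PiLp.inner_apply, Fin.sum_univ_two, mul_comm]

theorem orient_rotate (a b c : Plane) : orient b c a = orient a b c := by
  simp only [orient]; ring

theorem orient_swap (a b c : Plane) : orient a c b = -orient a b c := by
  simp only [orient]; ring

theorem orient_self_left (a b : Plane) : orient a a b = 0 := by
  simp only [orient]; ring

theorem orient_self_right (a b : Plane) : orient a b b = 0 := by
  simp only [orient]; ring

theorem orient_self_outer (a b : Plane) : orient a b a = 0 := by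
  simp only [orient]; ring

theorem orient_add_orient_add_orient (p x y z : Plane) :
    orient p y z + orient p z x + orient p x y = orient x y z := by
  simp only [orient]; ring

theorem orient_lineMap (a b x y : Plane) (t : ℝ) :
    orient a b (AffineMap.lineMap x y t) = (1 - t) * orient a b x + t * orient a b y := by
  simp only [orient, AffineMap.lineMap_apply, vsub_eq_sub, vadd_eq_add, PiLp.add_apply,
    PiLp.smul_apply, PiLp.sub_apply, smul_eq_mul]
  ring

theorem inner_pos_of_inner_pos_of_orient_left (hrx : 0 ≤ orient p r x) (hxy : 0 < orient p x y)
    (hry : 0 < orient p r y) (h : 0 < ⟪r - p, y - p⟫) : 0 < ⟪x - p, y - p⟫ := by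
  have decomposition : ⟪x - p, y - p⟫ * orient p r y =
      ⟪r - p, y - p⟫ * orient p x y + ⟪y - p, y - p⟫ * orient p r x := by
    simp only [inner_plane_eq, PiLp.sub_apply, orient]; ring
  have hnn : 0 ≤ ⟪y - p, y - p⟫ := real_inner_self_nonneg
  refine pos_of_mul_pos_left (decomposition ▸ ?_) hry.le
  positivity

theorem inner_pos_of_inner_pos_of_orient_right (hxy : 0 < orient p x y) (hyq : 0 ≤ orient p y q)
    (hxq : 0 < orient p x q) (h : 0 < ⟪x - p, q - p⟫) : 0 < ⟪x - p, y - p⟫ := by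
  have decomposition : ⟪x - p, y - p⟫ * orient p x q =
      ⟪x - p, q - p⟫ * orient p x y + ⟪x - p, x - p⟫ * orient p y q := by
    simp only [inner_plane_eq, PiLp.sub_apply, orient]; ring
  have hnn : 0 ≤ ⟪x - p, x - p⟫ := real_inner_self_nonneg
  refine pos_of_mul_pos_left (decomposition ▸ ?_) hxq.le
  positivity

theorem inner_nonpos_of_three_inner_pos (habc : 0 < orient a b c) (hacd : 0 < orient a c d)
    (habd : 0 < orient a b d) (hbcd : 0 < orient b c d) (ha : 0 < ⟪b - a, d - a⟫)
    (hb : 0 < ⟪a - b, c - b⟫) (hc : 0 < ⟪b - c, d - c⟫) : ⟪a - d, c - d⟫ ≤ 0 := by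
  have weighted_sum : orient a c d * ⟪a - b, c - b⟫ + orient a b c * ⟪a - d, c - d⟫ +
      orient b c d * ⟪b - a, d - a⟫ + orient a b d * ⟪b - c, d - c⟫ = 0 := by
    simp only [inner_plane_eq, PiLp.sub_apply, orient]; ring
  by_contra! hd
  have := mul_pos hacd hb
  have := mul_pos habc hd
  have := mul_pos hbcd ha
  have := mul_pos habd hc
  linarith

theorem dist_add_dist_lt_of_orient_pos (habc : 0 < orient a b c) (hacd : 0 < orient a c d)
    (habd : 0 < orient a b d) (hbcd : 0 < orient b c d) :
    dist a b + dist c d < dist a c + dist b d := by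
  have hsum : orient a b c + orient a c d = orient a b d + orient b c d := by
    simp only [orient]; ring
  set s := orient a b c + orient a c d with hs
  have hs0 : 0 < s := add_pos habc hacd
  set t := orient a b d / s with ht
  set r := orient a b c / s with hr
  have crossing : AffineMap.lineMap a c t = AffineMap.lineMap b d r := by
    refine PiLp.ext (Fin.forall_fin_two.2 ⟨?_, ?_⟩) <;>
    · simp only [AffineMap.lineMap_apply_module', PiLp.add_apply, PiLp.smul_apply, PiLp.sub_apply,
        smul_eq_mul, ht, hr]
      field_simp
      simp only [hs, orient]
      ring
  have ht01 : t ∈ Set.Icc 0 1 := ⟨by positivity, (div_le_one hs0).2 (by linarith)⟩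
  have hr01 : r ∈ Set.Icc 0 1 := ⟨by positivity, (div_le_one hs0).2 (by linarith)⟩
  refine dist_add_dist_lt_of_wbtw ⟨t, ht01, rfl⟩ ⟨r, hr01, crossing.symm⟩ ?_
  rintro ⟨k, -, hk⟩
  have on_line : orient a b (AffineMap.lineMap a c t) = 0 := by
    rw [← hk, orient_lineMap, orient_self_outer, orient_self_right]; ring
  have off_line : 0 < orient a b (AffineMap.lineMap a c t) := by
    rw [crossing, orient_lineMap, orient_self_right]
    have : 0 < r := by positivity
    have := mul_pos this habd
    linarith
  exact off_line.ne' on_line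

theorem mem_convexHull_of_orient_nonneg (hxyz : 0 < orient x y z) (hx : 0 ≤ orient p y z)
    (hy : 0 ≤ orient p z x) (hz : 0 ≤ orient p x y) : p ∈ convexHull ℝ {x, y, z} := by
  have barycentric : p = ∑ i, (![orient p y z, orient p z x, orient p x y] i / orient x y z) •
      ![x, y, z] i := by
    refine PiLp.ext (Fin.forall_fin_two.2 ⟨?_, ?_⟩) <;>
    · simp only [Fin.sum_univ_three, Matrix.cons_val, PiLp.add_apply, PiLp.smul_apply, smul_eq_mul]
      field_simp
      simp only [orient]
      ring
  rw [barycentric]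
  refine (convex_convexHull ℝ _).sum_mem (fun i _ => ?_) ?_ fun i _ => subset_convexHull ℝ _ ?_
  · exact div_nonneg (by fin_cases i <;> assumption) hxyz.le
  · rw [← Finset.sum_div, Fin.sum_univ_three, div_eq_one_iff_eq hxyz.ne']
    exact orient_add_orient_add_orient p x y z
  · fin_cases i <;> simp

theorem collinear_of_orient_eq_zero (h : orient x y z = 0) : Collinear ℝ {x, y, z} := by
  by_cases hxy : x = y
  · simpa [hxy] using collinear_pair ℝ y z
  have hpos : 0 < ⟪y - x, y - x⟫ := real_inner_self_pos.2 (sub_ne_zero.2 (Ne.symm hxy))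
  have hz : z = AffineMap.lineMap x y (⟪y - x, z - x⟫ / ⟪y - x, y - x⟫) := by
    simp only [inner_plane_eq, PiLp.sub_apply] at hpos ⊢
    simp only [orient] at h
    refine PiLp.ext (Fin.forall_fin_two.2 ⟨?_, ?_⟩) <;>
      rw [AffineMap.lineMap_apply_module', PiLp.add_apply, PiLp.smul_apply, PiLp.sub_apply,
        smul_eq_mul, ← sub_eq_iff_eq_add, div_mul_eq_mul_div, eq_div_iff hpos.ne']
    · linear_combination (-(y 1 - x 1)) * h
    · linear_combination (y 0 - x 0) * h
  rw [Set.pair_comm, Set.insert_comm, hz]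
  exact collinear_insert_of_mem_affineSpan_pair (AffineMap.lineMap_mem_affineSpan_pair _ _ _)

theorem ne_of_orient_pos (h : 0 < orient x y z) : x ≠ y ∧ y ≠ z ∧ x ≠ z := by
  refine ⟨?_, ?_, ?_⟩ <;> rintro rfl
  exacts [h.ne' (orient_self_left _ _), h.ne' (orient_self_right _ _),
    h.ne' (orient_self_outer _ _)]

/-- The order in which a ray rotating counterclockwise about the vertex `p` of a convex polygon
meets the vertices, starting with `p` itself. -/
def FanLT (p x y : Plane) : Prop :=
  (x = p ∧ y ≠ p) ∨ 0 < orient p x y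

end Geometry

namespace InConvexPosition

variable {S : Finset Plane} (hS : InConvexPosition S) {p x y z : Plane}

include hS

theorem notMem_convexHull {T : Set Plane} (hTS : T ⊆ S) (hp : p ∈ S) (hpT : p ∉ T) :
    p ∉ convexHull ℝ T := fun h =>
  convexIndependent_set_iff_notMem_convexHull_sdiff.1 hS p hp
    (convexHull_mono (Set.subset_sdiff_singleton hTS hpT) h)

theorem not_wbtw (hx : x ∈ S) (hy : y ∈ S) (hz : z ∈ S) (hxy : x ≠ y) (hyz : y ≠ z) :
    ¬ Wbtw ℝ x y z := by
  rw [← mem_segment_iff_wbtw, ← convexHull_pair]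
  refine hS.notMem_convexHull ?_ hy (by simp [hxy.symm, hyz])
  simp [Set.insert_subset_iff, hx, hz]

theorem orient_ne_zero (hx : x ∈ S) (hy : y ∈ S) (hz : z ∈ S) (hxy : x ≠ y) (hyz : y ≠ z)
    (hxz : x ≠ z) : orient x y z ≠ 0 := by
  intro h
  rcases (collinear_of_orient_eq_zero h).wbtw_or_wbtw_or_wbtw with h | h | h
  exacts [hS.not_wbtw hx hy hz hxy hyz h, hS.not_wbtw hy hz hx hyz hxz.symm h,
    hS.not_wbtw hz hx hy hxz.symm hxy h]

theorem orient_neg (hp : p ∈ S) (hx : x ∈ S) (hy : y ∈ S) (hz : z ∈ S)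
    (hpx : p ≠ x) (hpy : p ≠ y) (hpz : p ≠ z) (hxyz : 0 < orient x y z) (h₁ : 0 ≤ orient p y z)
    (h₂ : 0 ≤ orient p z x) : orient p x y < 0 := by
  by_contra! h₃
  refine hS.notMem_convexHull ?_ hp (by simp [hpx, hpy, hpz])
    (mem_convexHull_of_orient_nonneg hxyz h₁ h₂ h₃)
  simp [Set.insert_subset_iff, hx, hy, hz]

theorem orient_trans (hp : p ∈ S) (hx : x ∈ S) (hy : y ∈ S) (hz : z ∈ S)
    (hxy : 0 < orient p x y) (hyz : 0 < orient p y z) : 0 < orient p x z := by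
  by_contra! hxz
  have hzx : 0 ≤ orient p z x := by rw [orient_swap]; linarith
  have hxyz : 0 < orient x y z := by
    have := orient_add_orient_add_orient p x y z
    linarith
  have ⟨hpx, _, hpy⟩ := ne_of_orient_pos hxy
  exact (hS.orient_neg hp hx hy hz hpx hpy (ne_of_orient_pos hyz).2.2 hxyz hyz.le hzx).not_gt hxy

theorem orient_pos_of_fan (hp : p ∈ S) (hx : x ∈ S) (hy : y ∈ S) (hz : z ∈ S)
    (hxy : 0 < orient p x y) (hyz : 0 < orient p y z) : 0 < orient x y z := by
  have hxzp : 0 < orient x z p := orient_rotate p x z ▸ hS.orient_trans hp hx hy hz hxy hyz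
  have hyzp : 0 < orient y z p := by rwa [orient_rotate]
  have hypx : 0 < orient y p x := by rwa [← orient_rotate, ← orient_rotate] at hxy
  have ⟨hyz', _, hyp⟩ := ne_of_orient_pos hyzp
  have hyxz : orient y x z < 0 :=
    hS.orient_neg hy hx hz hp (ne_of_orient_pos hypx).2.2 hyz' hyp hxzp hyzp.le hypx.le
  rw [← orient_rotate, orient_swap]
  exact neg_pos.2 hyxz

theorem orient_pos_of_fanLT (hp : p ∈ S) (hx : x ∈ S) (hy : y ∈ S) (hz : z ∈ S)
    (hxy : FanLT p x y) (hyz : FanLT p y z) : 0 < orient x y z := by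
  have hyp : y ≠ p := hxy.elim And.right fun h => (ne_of_orient_pos h).2.2.symm
  have hyz : 0 < orient p y z := hyz.resolve_left fun h => hyp h.1
  rcases hxy with ⟨rfl, -⟩ | hxy
  · exact hyz
  · exact hS.orient_pos_of_fan hp hx hy hz hxy hyz

theorem isStrictTotalOrder_fanLT (hp : p ∈ S) :
    IsStrictTotalOrder S (fun x y => FanLT p x y) where
  irrefl x h := h.elim (fun h => h.2 h.1) fun h => h.ne' (orient_self_right _ _)
  trichotomous := by
    rintro ⟨x, hx⟩ ⟨y, hy⟩ hxy hyx
    by_contra hne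
    replace hne : x ≠ y := fun h => hne (Subtype.ext h)
    simp only [FanLT, not_or, not_and, not_not, orient_swap p x y] at hxy hyx
    have hxp : p ≠ x := fun h => hne (h.symm.trans (hxy.1 h.symm).symm)
    have hyp : p ≠ y := fun h => hne ((hyx.1 h.symm).trans h)
    exact hS.orient_ne_zero hp hx hy hxp hne hyp (by linarith)
  trans := by
    rintro ⟨x, hx⟩ ⟨y, hy⟩ ⟨z, hz⟩ hxy (⟨rfl, -⟩ | hyz)
    · exact (hxy.elim (fun h => h.2 rfl) fun h => (ne_of_orient_pos h).2.2 rfl).elim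
    · rcases hxy with ⟨rfl, -⟩ | hxy
      · exact .inl ⟨rfl, (ne_of_orient_pos hyz).2.2.symm⟩
      · exact .inr (hS.orient_trans hp hx hy hz hxy hyz)

end InConvexPosition

section CcwPolygon

open scoped RealInnerProductSpace

attribute [local grind →] SBtw.sbtw.cyclic_left SBtw.sbtw.trans_left ne_of_sbtw
attribute [local grind .] sbtw_or_sbtw_of_ne
attribute [local grind =] CyclicQuad

/-- The points `v i` are the vertices of a convex polygon, numbered counterclockwise. -/
def IsCcw {ι : Type*} [CircularOrder ι] (v : ι → Plane) : Prop :=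
  ∀ ⦃i j k⦄, sbtw i j k → 0 < orient (v i) (v j) (v k)

theorem InConvexPosition.exists_isCcw {S : Finset Plane} (hS : InConvexPosition S) :
    ∃ (n : ℕ) (v : Fin n ↪ Plane), Finset.univ.map v = S ∧ IsCcw v := by
  classical
  rcases S.eq_empty_or_nonempty with rfl | ⟨p, hp⟩
  · exact ⟨0, ⟨Fin.elim0, fun i => i.elim0⟩, by simp, fun i => i.elim0⟩
  have := hS.isStrictTotalOrder_fanLT hp
  let _ : LinearOrder S := linearOrderOfSTO (fun x y => FanLT p x y)
  let e : Fin S.card ≃o S := monoEquivOfFin S (by simp)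
  have orient_pos {i j k : Fin S.card} (hij : i < j) (hjk : j < k) :
      0 < orient (e i) (e j) (e k) :=
    hS.orient_pos_of_fanLT hp (e i).2 (e j).2 (e k).2 (e.lt_iff_lt.2 hij) (e.lt_iff_lt.2 hjk)
  refine ⟨S.card, e.toEmbedding.trans (.subtype _), ?_, fun i j k h => ?_⟩
  · ext x
    simp [e.exists_congr_left]
  · rcases Fin.sbtw_iff.1 h with ⟨hij, hjk⟩ | ⟨hjk, hki⟩ | ⟨hki, hij⟩
    · exact orient_pos hij hjk
    · exact orient_rotate _ _ _ ▸ orient_pos hjk hki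
    · exact (orient_rotate _ _ _).symm ▸ orient_pos hki hij

namespace IsCcw

variable {ι : Type*} [CircularOrder ι] {v : ι → Plane} (hv : IsCcw v) {p r x s q y : ι}

include hv

theorem dist_add_dist_lt {i j k l : ι} (quad : CyclicQuad i j k l) :
    dist (v i) (v j) + dist (v k) (v l) < dist (v i) (v k) + dist (v j) (v l) :=
  dist_add_dist_lt_of_orient_pos (hv quad.1) (hv quad.2) (hv (by grind)) (hv (by grind))

theorem inner_pos_left (quad : CyclicQuad p r x y)
    (hry : dist (v r) (v y) ≤ dist (v p) (v y)) : 0 < ⟪v x - v p, v y - v p⟫ :=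
  inner_pos_of_inner_pos_of_orient_left (hv quad.1).le (hv quad.2) (hv (by grind))
    (inner_sub_sub_pos_of_dist_le (ne_of_orient_pos (hv quad.1)).1.symm hry)

theorem inner_pos_right (quad : CyclicQuad p x y q)
    (hqx : dist (v q) (v x) ≤ dist (v p) (v x)) : 0 < ⟪v x - v p, v y - v p⟫ := by
  refine inner_pos_of_inner_pos_of_orient_right (hv quad.1) (hv quad.2).le (hv (by grind)) ?_
  rw [real_inner_comm]
  exact inner_sub_sub_pos_of_dist_le (ne_of_orient_pos (hv quad.2)).2.2.symm hqx

/-- Otherwise the quadrilateral `p x s y` would have four acute angles. -/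
theorem dist_lt_dist_of_hexagon (h₁ : CyclicQuad p r x s) (h₂ : CyclicQuad p s q y)
    (hp : dist (v r) (v y) ≤ dist (v p) (v y)) (hx : dist (v r) (v s) ≤ dist (v x) (v s))
    (hs : dist (v q) (v x) ≤ dist (v s) (v x)) : dist (v y) (v p) < dist (v q) (v p) := by
  have hpxy : sbtw p x y := by grind
  have hxsy : sbtw x s y := by grind
  have acute_p : 0 < ⟪v x - v p, v y - v p⟫ := hv.inner_pos_left ⟨h₁.1, hpxy⟩ hp
  have acute_x : 0 < ⟪v p - v x, v s - v x⟫ :=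
    real_inner_comm (v p - v x) _ ▸ hv.inner_pos_right (by grind) hx
  have acute_s : 0 < ⟪v x - v s, v y - v s⟫ :=
    real_inner_comm (v x - v s) _ ▸ hv.inner_pos_left (by grind) hs
  by_contra! hy
  have acute_y : 0 < ⟪v p - v y, v s - v y⟫ := hv.inner_pos_right (by grind) hy
  exact acute_y.not_ge (inner_nonpos_of_three_inner_pos (hv h₁.2) (hv (by grind)) (hv hpxy)
    (hv hxsy) acute_p acute_x acute_s)

end IsCcw

/-- The graph on the indices of the points `v i` whose edges are the pairs at a distance in `D`. -/
def distGraph {ι P : Type*} [PseudoMetricSpace P] (v : ι → P) (D : Set ℝ) : SimpleGraph ι where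
  Adj i j := i ≠ j ∧ dist (v i) (v j) ∈ D
  symm := ⟨fun i j h => ⟨h.1.symm, dist_comm (v i) (v j) ▸ h.2⟩⟩
  loopless := ⟨fun _ h => h.1 rfl⟩

theorem distGraph_pair {ι P : Type*} [PseudoMetricSpace P] (v : ι → P) (d r : ℝ) :
    distGraph v ({d, r} : Finset ℝ) = distGraph v {d} ⊔ distGraph v {r} := by
  ext i j
  simp [distGraph, and_or_left]

theorem disjoint_distGraph {ι P : Type*} [PseudoMetricSpace P] (v : ι → P) {D E : Set ℝ}
    (h : Disjoint D E) : Disjoint (distGraph v D) (distGraph v E) :=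
  SimpleGraph.disjoint_left.2 fun _ _ hD hE => Set.disjoint_left.1 h hD.2 hE.2

theorem IsCcw.isTopTwo_distGraph {ι : Type*} [CircularOrder ι] {v : ι → Plane} (hv : IsCcw v)
    {d r : ℝ} (hrd : r < d)
    (hdist : ∀ i j, i ≠ j → dist (v i) (v j) ≤ r ∨ dist (v i) (v j) = d) :
    IsTopTwo (distGraph v {d}) (distGraph v {r}) where
  disjoint hd hr := hrd.ne (hr.2.symm.trans hd.2)
  cross {i j k l} quad hij hkl := by
    have := hv.dist_add_dist_lt quad
    grind [distGraph]
  cross_mixed {i j k l} quad hij hkl := by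
    have := hv.dist_add_dist_lt quad
    grind [distGraph]
  cross_second {i j k l} quad hij hkl := by
    have := hv.dist_add_dist_lt quad
    grind [distGraph]
  hexagon h₁ h₂ hry hpy hpq hrs hxs hxq :=
    (hv.dist_lt_dist_of_hexagon h₁ h₂ (hry.2.trans hpy.2.symm).le (hrs.2.trans hxs.2.symm).le
      (hxq.symm.2.trans hxs.symm.2.symm).le).ne (hpy.symm.2.trans hpq.symm.2.symm)

end CcwPolygon

section Distances

theorem dist_mem_distances {S : Finset Plane} {x y : Plane} (hx : x ∈ S) (hy : y ∈ S)
    (hxy : x ≠ y) : dist x y ∈ distances S := by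
  classical
  exact Finset.mem_image.2 ⟨(x, y), Finset.mem_offDiag.2 ⟨hx, hy, hxy⟩, rfl⟩

namespace IsNthDistance

variable {S : Finset Plane} {i : ℕ} {r s t d : ℝ}

theorem not_lt (hr : IsNthDistance S i r) (hs : IsNthDistance S i s) : ¬ r < s := by
  classical
  intro hrs
  have larger : (distances S).filter (s < ·) ⊂ (distances S).filter (r < ·) := by
    refine (Finset.ssubset_iff_of_subset (by grind)).2 ⟨s, ?_, by simp⟩
    exact Finset.mem_filter.2 ⟨hs.1, hrs⟩
  have := Finset.card_lt_card larger
  have := hr.2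
  have := hs.2
  grind

theorem unique (hr : IsNthDistance S i r) (hs : IsNthDistance S i s) : r = s :=
  le_antisymm (le_of_not_gt (hs.not_lt hr)) (le_of_not_gt (hr.not_lt hs))

theorem le_of_one (hd : IsNthDistance S 1 d) (ht : t ∈ distances S) : t ≤ d := by
  classical
  have none_larger : (distances S).filter (d < ·) = ∅ :=
    Finset.card_eq_zero.1 (Nat.succ_injective hd.2)
  exact le_of_not_gt fun h => Finset.filter_eq_empty_iff.1 none_larger ht h

theorem exists_pred (hr : IsNthDistance S (i + 2) r) :
    ∃ d, IsNthDistance S (i + 1) d ∧ r < d ∧ ∀ t ∈ distances S, t ≤ r ∨ d ≤ t := by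
  classical
  set L := (distances S).filter (r < ·)
  have card_L : L.card = i + 1 := Nat.succ_injective hr.2
  obtain ⟨d, hdL, hmin⟩ := L.exists_min_image id (Finset.card_pos.1 (by lia))
  obtain ⟨hd, hrd⟩ := Finset.mem_filter.1 hdL
  have erase_L : (distances S).filter (d < ·) = L.erase d := by
    ext t
    have := hmin t
    grind
  refine ⟨d, ⟨hd, ?_⟩, hrd, fun t ht => ?_⟩
  · rw [← card_L, ← Finset.card_erase_add_one hdL, ← erase_L]
  · exact (le_or_gt t r).imp_right fun h => hmin t (Finset.mem_filter.2 ⟨ht, h⟩)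

theorem eq_or_eq_of_le (hd : IsNthDistance S 1 d) (hr : IsNthDistance S 2 r)
    (ht : t ∈ distances S) (hrt : r ≤ t) : t = d ∨ t = r := by
  obtain ⟨d', hd', -, hle⟩ := hr.exists_pred
  obtain rfl := hd.unique hd'
  exact (hle t ht).symm.imp (le_antisymm (hd.le_of_one ht)) (le_antisymm · hrt)

end IsNthDistance

variable {ι : Type*} [Fintype ι] {v : ι ↪ Plane}

open Finset in
open scoped Classical in
theorem distMultiplicity_map_univ {i : ℕ} {r : ℝ} (hr : IsNthDistance (univ.map v) i r) :
    distMultiplicity (univ.map v) i = #(distGraph v {r}).edgeFinset := by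
  have nth_iff (t : ℝ) : IsNthDistance (univ.map v) i t ↔ t = r :=
    ⟨fun ht => ht.unique hr, fun h => h ▸ hr⟩
  rw [← card_image_of_injective _ (Sym2.map.injective v.injective), distMultiplicity]
  congr 1
  ext e
  simp only [nth_iff, mem_image, mem_filter, mem_offDiag, Prod.exists, SimpleGraph.mem_edgeFinset]
  constructor
  · rintro ⟨x, y, ⟨⟨hx, hy, hxy⟩, hr⟩, rfl⟩
    obtain ⟨i, -, rfl⟩ := mem_map.1 hx
    obtain ⟨j, -, rfl⟩ := mem_map.1 hy
    exact ⟨s(i, j), ⟨fun h => hxy (congrArg v h), hr⟩, rfl⟩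
  · rintro ⟨e, he, rfl⟩
    induction e with | h i j
    exact ⟨v i, v j, ⟨⟨by simp, by simp, v.injective.ne he.1⟩, he.2⟩, rfl⟩

open Finset in
open scoped Classical in
theorem card_commonNeighbors_distGraph_le {V P : Type*} [NormedAddCommGroup V]
    [InnerProductSpace ℝ V] [MetricSpace P] [NormedAddTorsor V P] [FiniteDimensional ℝ V]
    (hV : Module.finrank ℝ V = 2) (v : ι ↪ P) (D : Finset ℝ) {u u' : ι} (hu : u ≠ u') :
    #{w | (distGraph v D).Adj u w ∧ (distGraph v D).Adj u' w} ≤ 2 * #D ^ 2 := by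
  let distPair (w : ι) : ℝ × ℝ := (dist (v w) (v u), dist (v w) (v u'))
  have maps_to : ∀ w ∈ ({w | (distGraph v D).Adj u w ∧ (distGraph v D).Adj u' w} : Finset ι),
      distPair w ∈ D ×ˢ D := by
    intro w hw
    obtain ⟨hw, hw'⟩ := (mem_filter.1 hw).2
    exact mem_product.2 ⟨hw.symm.2, hw'.symm.2⟩
  rw [sq, ← card_product]
  refine card_le_mul_card_image_of_maps_to maps_to 2 fun t _ => ?_
  by_contra! hcard
  obtain ⟨x, y, z, hx, hy, hz, hxy, hxz, hyz⟩ := two_lt_card_iff.1 hcard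
  simp only [mem_filter, distPair, Prod.ext_iff] at hx hy hz
  rcases EuclideanGeometry.eq_of_dist_eq_of_dist_eq_of_finrank_eq_two hV (v.injective.ne hu)
    (v.injective.ne hxy) hx.2.1 hy.2.1 hz.2.1 hx.2.2 hy.2.2 hz.2.2 with h | h
  · exact hxz (v.injective h).symm
  · exact hyz (v.injective h).symm

open Finset in
open scoped Classical in
theorem IsCcw.exists_isTopTwo [CircularOrder ι] (hv : IsCcw v) {r : ℝ}
    (hr : IsNthDistance (univ.map v) 2 r) :
    ∃ d, IsNthDistance (univ.map v) 1 d ∧ r < d ∧ IsTopTwo (distGraph v {d}) (distGraph v {r}) := by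
  obtain ⟨d, hd, hrd, hle⟩ := hr.exists_pred
  refine ⟨d, hd, hrd, hv.isTopTwo_distGraph hrd fun i j hij => ?_⟩
  have hij : dist (v i) (v j) ∈ distances (univ.map v) :=
    dist_mem_distances (by simp) (by simp) (v.injective.ne hij)
  exact (hle _ hij).imp_right fun h => le_antisymm (hd.le_of_one hij) h

end Distances

theorem InConvexPosition.three_mul_distMultiplicity_two_le {S : Finset Plane}
    (hS : InConvexPosition S) : 3 * distMultiplicity S 2 ≤ 4 * S.card := by
  classical
  by_cases hr : ∃ r, IsNthDistance S 2 r
  · obtain ⟨r, hr⟩ := hr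
    obtain ⟨n, v, rfl, hv⟩ := hS.exists_isCcw
    obtain ⟨d, -, -, h⟩ := hv.exists_isTopTwo hr
    rw [distMultiplicity_map_univ hr, Finset.card_map, Finset.card_univ]
    exact h.three_mul_card_edgeFinset_le isNext_finRotate
  · have : distMultiplicity S 2 = 0 := by
      simp [distMultiplicity, not_exists.1 hr]
    lia

open Finset in
open scoped Classical in
theorem topMultiplicity_two_map_univ {ι : Type*} [Fintype ι] {v : ι ↪ Plane} {d r : ℝ}
    (hd : IsNthDistance (univ.map v) 1 d) (hr : IsNthDistance (univ.map v) 2 r) (hrd : r < d) :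
    topMultiplicity (univ.map v) 2 = #(distGraph v ({d, r} : Finset ℝ)).edgeFinset := by
  have edges_disjoint :
      Disjoint (distGraph v {d}).edgeFinset (distGraph v {r}).edgeFinset :=
    SimpleGraph.disjoint_edgeFinset.2 (disjoint_distGraph v (by simpa using hrd.ne'))
  rw [topMultiplicity, sum_Icc_succ_top (by norm_num), Icc_self, sum_singleton,
    distMultiplicity_map_univ hd, distMultiplicity_map_univ hr,
    ← card_union_of_disjoint edges_disjoint, ← SimpleGraph.edgeFinset_sup]
  congr! 2
  exact (distGraph_pair v d r).symm

open Finset in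
open scoped Classical in
theorem IsCcw.card_sbtw_le_card_verticesBetween {ι : Type*} [Fintype ι] [CircularOrder ι]
    {v : ι ↪ Plane} (hv : IsCcw v) (i j : ι) :
    #{k | sbtw i j k} ≤ #(verticesBetween (univ.map v) (v i) (v j)) := by
  rw [← card_map v]
  refine card_le_card fun x hx => ?_
  obtain ⟨k, hk, rfl⟩ := mem_map.1 hx
  exact mem_filter.2 ⟨by simp, hv (mem_filter.1 hk).2⟩

theorem isSpecialDiagonalConstant_two (l : ℕ) :
    IsSpecialDiagonalConstant 2 l (8 * (l + 6) ^ 2 : ℕ) := by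
  classical
  rintro S hS ⟨a, ha, b, hb, hab, ⟨r, hr, hrab⟩, hl⟩
  obtain ⟨n, v, rfl, hv⟩ := hS.exists_isCcw
  obtain ⟨d, hd, hrd, h⟩ := hv.exists_isTopTwo hr
  obtain ⟨i, -, rfl⟩ := Finset.mem_map.1 ha
  obtain ⟨j, -, rfl⟩ := Finset.mem_map.1 hb
  have adj : (distGraph v ({d, r} : Finset ℝ)).Adj j i := by
    rw [SimpleGraph.adj_comm]
    exact ⟨fun h => hab (congrArg v h), by
      simpa using hd.eq_or_eq_of_le hr (dist_mem_distances ha hb hab) hrab⟩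
  obtain ⟨F, hF, card_F⟩ := h.exists_isVertexCover (distGraph_pair v d r ▸ adj)
  have card_F : F.card ≤ l + 6 := by
    have := hv.card_sbtw_le_card_verticesBetween i j
    lia
  have card_edges := card_edgeFinset_le_of_isVertexCover ((distGraph_pair v d r).symm ▸ hF)
    fun u _ u' _ => card_commonNeighbors_distGraph_le (by simp) v {d, r}
  rw [Finset.card_pair hrd.ne', ← topMultiplicity_two_map_univ hd hr hrd] at card_edges
  rw [Finset.card_map, Finset.card_univ]
  exact_mod_cast card_edges.trans (by gcongr; norm_num)

theorem mainTheorem4_general :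
    (∀ S : Finset Plane, InConvexPosition S → (distMultiplicity S 2 : ℝ) ≤ 4 / 3 * S.card) ∧
    ∀ l : ℕ, ∃ C : ℝ, IsSpecialDiagonalConstant 2 l C := by
  refine ⟨fun S hS => ?_, fun l => ⟨_, isSpecialDiagonalConstant_two l⟩⟩
  have : (3 * distMultiplicity S 2 : ℝ) ≤ 4 * S.card :=
    mod_cast hS.three_mul_distMultiplicity_two_le
  linarith

theorem mainTheorem4 :
    (∃ N : ℕ, ∀ n : ℕ, N ≤ n → ∀ S : Finset Plane, S.card = n → InConvexPosition S →
      (distMultiplicity S 2 : ℝ) ≤ 4 / 3 * (n : ℝ)) ∧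
    (∃ C : ℝ, IsSpecialDiagonalConstant 2 16 C) ∧
    (∀ C : ℝ, IsSpecialDiagonalConstant 2 16 C →
      ∀ n : ℕ, 3 * C ≤ (n : ℝ) → ∀ S : Finset Plane, S.card = n → InConvexPosition S →
        (distMultiplicity S 2 : ℝ) ≤ 4 / 3 * (n : ℝ)) := by
  obtain ⟨bound, exists_constant⟩ := mainTheorem4_general
  exact ⟨⟨0, by rintro n - S rfl hS; exact bound S hS⟩, exists_constant 16,
    by rintro C - n - S rfl hS; exact bound S hS⟩
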